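/- **Definition.** A real random process $\{x[k]\}_{k\ge 1}$ on a probability space is called ARMA$(p,q)$ (with $p,q\ge 0$ integers) if there are real coefficients $\beta_0=1,\beta_1,\dots,\beta_p$ and $\alpha_0,\dots,\alpha_q$ and independent standard normal random variables $\{\epsilon[i]\}_{i\in\mathbb Z}$ on the same probability space such that, almost surely, $$\sum_{j=0}^{p}\beta_j\,x[k-j]=\sum_{j=0}^{q}\alpha_j\,\epsilon[k-j]$$ for every $k\ge p+1$ (i.e. whenever all the terms $x[k],\dots,x[k-p]$ belong to the process; the initial values $x[1],\dots,x[p]$ are not restricted). **Setting.** Let $L\ge 0$ be an integer and $h[1],\dots,h[L]\in\mathbb R$ the filter taps of the relay. For $N\ge 1$ let $\mathbf H=\mathbf H_N$ be the $N\times N$ lower triangular banded Toeplitz matrix with ones on the diagonal, $h[\ell]$ on the $\ell$-th subdiagonal for $1\le \ell\le L$, and zeros elsewhere. Let $\{w[k]\}_{k\ge1}$ (source-to-relay noise) and $\{z[k]\}_{k\ge1}$ (relay-to-destination noise) be real random processes on a common probability space that are independent of each other. The effective noise of block length $N$ is $$\widetilde{\mathbf z}=(\mathbf I-\mathbf H^{-1})\mathbf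 w+\mathbf H^{-1}\mathbf z,\qquad \mathbf w=(w[1],\dots,w[N])^T,\ \mathbf z=(z[1],\dots,z[N])^T .$$ Since $\mathbf H_N$ is lower triangular, the $k$-th coordinate $\widetilde z[k]$ does not depend on $N\ge k$, so this defines a process $\{\widetilde z[k]\}_{k\ge 1}$. **Proposition.** If $\{w[k]\}_{k\ge1}$ is an ARMA$(p_1,q_1)$ process and $\{z[k]\}_{k\ge1}$ is an ARMA$(p_2,q_2)$ process, then $\{\widetilde z[k]\}_{k\ge1}$ is an ARMA$(p,q)$ process for some integers $p,q\ge 0$ with $$p\le L+p_1+p_2,\qquad q\le\max(L+p_2+q_1-1,\;p_1+q_2).$$ -/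

import Mathlib

open MeasureTheory ProbabilityTheory

/-- `IsARMA p q X μ`: the real random process `X`, started at a first time instant and indexed so that
`X k` is its value at time `k + 1`, is an ARMA`(p, q)` process on the probability space `(Ω, μ)`:
there are i.i.d. standard normal variables `ε i` (indexed by all integers, because the moving-average
part reaches back `q` steps) and real coefficients with `β 0 = 1` such that
`∑_{j=0}^{p} β_j X[k-j] = ∑_{j=0}^{q} α_j ε[k-j]` almost surely, at every time at which
all of `X[k], …, X[k-p]` are terms of the process. -/
def IsARMA {Ω : Type*} [MeasurableSpace Ω] (p q : ℕ) (X : ℕ → Ω → ℝ) (μ : Measure Ω) : Prop :=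
  ∃ (β α : ℕ → ℝ) (ε : ℤ → Ω → ℝ),
    β 0 = 1 ∧
    (∀ i, HasLaw (ε i) (gaussianReal 0 1) μ) ∧
    iIndepFun ε μ ∧
    ∀ k : ℕ, p ≤ k →
      ∀ᵐ ω ∂μ, ∑ j ∈ Finset.range (p + 1), β j * X (k - j) ω
        = ∑ j ∈ Finset.range (q + 1), α j * ε ((k : ℤ) - (j : ℤ)) ω

/-- The `N × N` lower triangular banded Toeplitz matrix `H` of a relay with the `L` filter taps
`h 1, …, h L`: ones on the diagonal, `h ℓ` on the `ℓ`-th subdiagonal for `1 ≤ ℓ ≤ L`, and zeros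
elsewhere. -/
def relayMatrix (L : ℕ) (h : ℕ → ℝ) (N : ℕ) : Matrix (Fin N) (Fin N) ℝ :=
  Matrix.of fun i j =>
    if i = j then 1
    else if j < i ∧ (i : ℕ) - (j : ℕ) ≤ L then h ((i : ℕ) - (j : ℕ))
    else 0

/-- The effective noise vector `(I - H⁻¹) w + H⁻¹ z` of block length `N`; coordinate `i` belongs to
time `i + 1`. -/
noncomputable def effectiveNoiseVec (L : ℕ) (h : ℕ → ℝ) (N : ℕ) (w z : Fin N → ℝ) : Fin N → ℝ :=
  (1 - (relayMatrix L h N)⁻¹).mulVec w + (relayMatrix L h N)⁻¹.mulVec z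

/-- The effective noise process: its value at time `k + 1` is the last coordinate of the effective
noise vector of block length `k + 1`.  By `effectiveNoise_eq_vec` every larger block length gives
the same value. -/
noncomputable def effectiveNoise {Ω : Type*} (L : ℕ) (h : ℕ → ℝ) (w z : ℕ → Ω → ℝ) :
    ℕ → Ω → ℝ :=
  fun k ω => effectiveNoiseVec L h (k + 1) (fun i => w i ω) (fun i => z i ω) (Fin.last k)

theorem relayMatrix_det (L : ℕ) (h : ℕ → ℝ) (N : ℕ) : (relayMatrix L h N).det = 1 := by
  rw [Matrix.det_of_isLowerTriangular]
  · simp [relayMatrix]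
  · intro i j hij
    have hij' : i < j := by simpa using hij
    simp [relayMatrix, hij'.ne, not_lt.mpr hij'.le]

/-- The effective noise vector solves `H v = (H - I) w + z`. -/
theorem relayMatrix_mulVec_effectiveNoiseVec (L : ℕ) (h : ℕ → ℝ) (N : ℕ) (w z : Fin N → ℝ) :
    (relayMatrix L h N).mulVec (effectiveNoiseVec L h N w z)
      = (relayMatrix L h N).mulVec w - w + z := by
  have hu : IsUnit (relayMatrix L h N).det := by rw [relayMatrix_det]; exact isUnit_one
  simp [effectiveNoiseVec, Matrix.mulVec_add, Matrix.mul_nonsing_inv _ hu, Matrix.sub_mulVec,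
    Matrix.mulVec_sub]

/-- Restricting to the first `n` coordinates commutes with the lower triangular matrix `H`. -/
theorem relayMatrix_mulVec_castLE (L : ℕ) (h : ℕ → ℝ) {n N : ℕ} (hn : n ≤ N) (v : Fin N → ℝ)
    (i : Fin n) :
    (relayMatrix L h N).mulVec v (Fin.castLE hn i)
      = (relayMatrix L h n).mulVec (fun j => v (Fin.castLE hn j)) i := by
  simp only [Matrix.mulVec, dotProduct]
  symm
  refine Finset.sum_of_injOn (Fin.castLE hn) (Fin.castLE_injective hn).injOn (by simp) ?_ ?_
  · intro j _ hj
    have hj' : n ≤ (j : ℕ) := by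
      by_contra hlt
      exact hj ⟨⟨j, by omega⟩, by simp, by ext; simp⟩
    have h1 : Fin.castLE hn i ≠ j := by
      intro e
      have := congrArg Fin.val e
      simp at this
      omega
    have h2 : ¬ j < Fin.castLE hn i := by
      rw [Fin.lt_def]
      simp
      omega
    simp [relayMatrix, h1, h2]
  · intro j _
    simp [relayMatrix, (Fin.castLE_injective hn).eq_iff]

/-- The effective noise process does not depend on the block length. -/
theorem effectiveNoise_eq_vec {Ω : Type*} (L : ℕ) (h : ℕ → ℝ) (w z : ℕ → Ω → ℝ) (N : ℕ)
    (k : Fin N) (ω : Ω) :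
    effectiveNoise L h w z k ω
      = effectiveNoiseVec L h N (fun i => w i ω) (fun i => z i ω) k := by
  have hn : (k : ℕ) + 1 ≤ N := k.isLt
  have hu : IsUnit (relayMatrix L h ((k : ℕ) + 1)) := by
    rw [Matrix.isUnit_iff_isUnit_det, relayMatrix_det]; exact isUnit_one
  have key : effectiveNoiseVec L h ((k : ℕ) + 1) (fun i => w i ω) (fun i => z i ω)
      = fun j => effectiveNoiseVec L h N (fun i => w i ω) (fun i => z i ω) (Fin.castLE hn j) := by
    apply Matrix.mulVec_injective_of_isUnit hu
    funext i
    rw [relayMatrix_mulVec_effectiveNoiseVec, ← relayMatrix_mulVec_castLE,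
      relayMatrix_mulVec_effectiveNoiseVec]
    simp [relayMatrix_mulVec_castLE]
  have := congrFun key (Fin.last k)
  exact this

/-! Let polynomials act on sequences by the forward shift. The noise `x` satisfies `(X^L + G) x = G
w + X^L z`, where `G` collects the taps and has degree at most `L - 1` because the diagonal of `H -
I` vanishes. Multiplying by the autoregressive polynomials `B₁`, `B₂` gives `(X^L + G) B₁ B₂ x = B₂
G u + X^L B₁ v`, where `u = B₁ w = a₁ e₁` and `v = B₂ z = a₂ e₂` are independent moving averages. It
remains to write the right-hand side as a single moving average.

Spectrally this is Fejér–Riesz: `exists_mul_reflect_eq_add` finds a real `D` with `D D* = A A* + B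
B*` for `A = B₂ G a₁`, `B = B₁ a₂`. The delay `X^L` does not affect the spectrum, hence the bound on
`q`.

The white noise driving `D` must live on the given space, which might carry no further randomness.
Moreover `e₁` and `e₂` need not be independent of each other; only `u` and `v` are. So a standard
normal `g`, independent of the output, is built linearly from `u` and `v` in the direction
orthogonal to the output (`coeffSqSum_add_coeffSqSum`). This one variable supplies enough randomness
to sample the noise from its conditional law given the output (`exists_map_prodMk_eq`,
`exists_whiteNoise_of_shiftAct_add`). -/

/-! ### Reversed polynomials and Fejér–Riesz factorisation. -/

open Polynomial ComplexConjugate in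
theorem aeval_reflect_of_norm_eq_one {Q : ℝ[X]} {k : ℕ} (hk : Q.natDegree ≤ k) {z : ℂ}
    (hz : ‖z‖ = 1) : aeval z (reflect k Q) = z ^ k * conj (aeval z Q) := by
  have h0 : z ≠ 0 := by
    rintro rfl
    simp at hz
  have hc : z⁻¹ = conj z := Complex.inv_eq_conj hz
  let _ : Invertible z⁻¹ := invertibleOfNonzero (inv_ne_zero h0)
  have h := eval₂_reflect_mul_pow (algebraMap ℝ ℂ) z⁻¹ k Q hk
  rw [invOf_eq_inv, inv_inv, ← aeval_def, ← aeval_def] at h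
  rw [← aeval_conj, ← hc, ← h, mul_comm, mul_assoc, ← mul_pow, inv_mul_cancel₀ h0, one_pow, mul_one]

-- On the unit circle `z⁻¹ = conj z`, so reversal is conjugation up to a power of `z`. An
-- autocorrelation is thus nonnegative there, and zero only at zeros of `Q`.
open Polynomial ComplexConjugate in
theorem conj_pow_mul_aeval_mul_reflect {Q : ℝ[X]} {k : ℕ} (hk : Q.natDegree ≤ k) {z : ℂ}
    (hz : ‖z‖ = 1) :
    conj z ^ k * aeval z (Q * reflect k Q) = ((Complex.normSq (aeval z Q) : ℝ) : ℂ) := by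
  rw [map_mul, aeval_reflect_of_norm_eq_one hk hz, ← Complex.mul_conj]
  have : (conj z) ^ k * z ^ k = 1 := by
    rw [← mul_pow, mul_comm, Complex.mul_conj, Complex.normSq_eq_norm_sq, hz]
    simp
  linear_combination aeval z Q * conj (aeval z Q) * this

open Polynomial in
theorem natDegree_reflect_le_of_le {R : Type*} [Semiring R] {P : R[X]} {n : ℕ}
    (h : P.natDegree ≤ n) : (reflect n P).natDegree ≤ n :=
  natDegree_reflect_le.trans (max_le le_rfl h)

/-- A complex root of a real polynomial is a root of a monic real factor all of whose complex roots
have the same modulus. -/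
theorem exists_monic_dvd_of_aeval_eq_zero {P : Polynomial ℝ} {r : ℂ}
    (hr : Polynomial.aeval r P = 0) :
    ∃ Q : Polynomial ℝ, Q.Monic ∧ 1 ≤ Q.natDegree ∧ Q ∣ P ∧
      ∀ w : ℂ, Polynomial.aeval w Q = 0 → ‖w‖ = ‖r‖ := by
  open Polynomial ComplexConjugate in
  by_cases him : r.im = 0
  · obtain ⟨x, rfl⟩ : ∃ x : ℝ, (x : ℂ) = r := ⟨r.re, by apply Complex.ext <;> simp [him]⟩
    refine ⟨X - C x, monic_X_sub_C x, by simp, ?_, ?_⟩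
    · rw [dvd_iff_isRoot, IsRoot.def]
      have h1 : aeval (algebraMap ℝ ℂ x) P = 0 := hr
      rw [aeval_algebraMap_apply] at h1
      simpa using h1
    · intro w hw
      have : w = x := by simpa [sub_eq_zero] using hw
      rw [this]
  · have hdeg : (C (-(2 * r.re)) * X + C (‖r‖ ^ 2) : ℝ[X]).degree < 2 :=
      lt_of_le_of_lt degree_linear_le (by decide)
    have hQ : X ^ 2 - C (2 * r.re) * X + C (‖r‖ ^ 2)
        = X ^ 2 + (C (-(2 * r.re)) * X + C (‖r‖ ^ 2) : ℝ[X]) := by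
      simp only [map_neg]
      ring
    refine ⟨X ^ 2 - C (2 * r.re) * X + C (‖r‖ ^ 2), ?_, ?_,
      quadratic_dvd_of_aeval_eq_zero_im_ne_zero P hr him, ?_⟩
    · rw [hQ]
      exact monic_X_pow_add hdeg
    · rw [hQ, natDegree_eq_of_degree_eq_some (degree_add_eq_left_of_degree_lt
        (by rw [degree_X_pow]; exact hdeg) |>.trans (degree_X_pow 2))]
      norm_num
    · intro w hw
      have h1 : (w - r) * (w - conj r) = 0 := by
        have e1 := Complex.add_conj r
        have e2 := Complex.mul_conj' r
        have e3 : w ^ 2 - 2 * (r.re : ℂ) * w + (‖r‖ : ℂ) ^ 2 = 0 := by simpa using hw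
        push_cast at e1
        linear_combination e3 + e2 - w * e1
      rcases mul_eq_zero.1 h1 with h | h
      · rw [sub_eq_zero.1 h]
      · rw [sub_eq_zero.1 h, Complex.norm_conj]

open Polynomial ComplexConjugate in
/-- **Fejér–Riesz** for self-reciprocal real polynomials that are positive on the unit circle. -/
theorem exists_mul_reflect_eq_of_pos (n : ℕ) : ∀ P : ℝ[X], P.natDegree ≤ 2 * n →
    reflect (2 * n) P = P → (∀ z : ℂ, ‖z‖ = 1 → 0 < (conj z ^ n * aeval z P).re) →
    ∃ D : ℝ[X], D.natDegree ≤ n ∧ D * reflect n D = P := by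
  induction n using Nat.strong_induction_on with
  | _ n ih =>
  intro P hdeg hrefl hpos
  have hP0 : P ≠ 0 := by
    rintro rfl
    simpa using hpos 1 (by simp)
  rcases Nat.eq_zero_or_pos n with rfl | hn
  · obtain ⟨p, rfl⟩ : ∃ p, P = C p := ⟨_, eq_C_of_natDegree_le_zero (by simpa using hdeg)⟩
    have hp : 0 < p := by simpa using hpos 1 (by simp)
    refine ⟨C (√p), by simp, ?_⟩
    rw [reflect_C, pow_zero, mul_one, ← C_mul, Real.mul_self_sqrt hp.le]
  -- A root at `0` has its mirror image at infinity: by symmetry the top coefficient vanishes too,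
  -- so removing `X` lowers `n` by one.
  by_cases h0 : P.coeff 0 = 0
  · obtain ⟨R, rfl⟩ := X_dvd_iff.2 h0
    have hR0 : R ≠ 0 := right_ne_zero_of_mul hP0
    obtain ⟨m, rfl⟩ : ∃ m, n = m + 1 := ⟨n - 1, by omega⟩
    have hRd : R.natDegree ≤ 2 * m := by
      rw [natDegree_X_mul hR0] at hdeg
      have h1 : R.coeff (2 * m + 1) = 0 := by
        rw [← coeff_X_mul, ← hrefl, coeff_reflect, revAt_le (by omega)]
        simp [show 2 * (m + 1) - (2 * m + 1 + 1) = 0 by omega]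
      have h2 : R.natDegree ≠ 2 * m + 1 := by
        intro h
        rw [← h, coeff_natDegree, leadingCoeff_eq_zero] at h1
        exact hR0 h1
      omega
    have hRr : reflect (2 * m) R = R := by
      rw [show 2 * (m + 1) = 2 + 2 * m by ring,
        reflect_mul X R (F := 2) (by simp) hRd] at hrefl
      have h1 : reflect 2 (X : ℝ[X]) = X := by
        simpa [revAt_le] using reflect_monomial (R := ℝ) 2 1
      rw [h1] at hrefl
      exact mul_left_cancel₀ X_ne_zero hrefl
    obtain ⟨D, hD, hDR⟩ := ih m (by omega) R hRd hRr (by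
      intro z hz
      have h1 := hpos z hz
      have h2 : conj z * z = 1 := by
        rw [mul_comm, Complex.mul_conj, Complex.normSq_eq_norm_sq, hz]
        simp
      rw [map_mul, aeval_X, pow_succ,
        show conj z ^ m * conj z * (z * aeval z R) = (conj z * z) * (conj z ^ m * aeval z R) by
          ring, h2, one_mul] at h1
      exact h1)
    refine ⟨D, by omega, ?_⟩
    have h1 : reflect (m + 1) D = X * reflect m D := by
      have := reflect_mul (1 : ℝ[X]) D (F := 1) (G := m) (by simp) hD
      rwa [one_mul, reflect_one, pow_one, add_comm] at this
    rw [h1, ← hDR]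
    ring
  · have hdegP : P.natDegree = 2 * n := by
      refine le_antisymm hdeg (le_natDegree_of_ne_zero ?_)
      rw [← hrefl, coeff_reflect, revAt_le le_rfl]
      simpa using h0
    obtain ⟨r, hr⟩ := IsAlgClosed.exists_aeval_eq_zero ℂ P
      (by rw [degree_eq_natDegree hP0, hdegP]; exact_mod_cast (by omega : 2 * n ≠ 0))
    -- Positivity keeps roots off the circle. The roots of `Q` have modulus `‖r‖` and those of its
    -- reversal `‖r‖⁻¹`, so the two are coprime and their product divides `P`.
    have hr1 : ‖r‖ ≠ 1 := fun h => by simpa [hr] using hpos r h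
    obtain ⟨Q, hQm, hQ1, ⟨R, hPR⟩, hQr⟩ := exists_monic_dvd_of_aeval_eq_zero hr
    set k := Q.natDegree with hk
    have hQ0 : Q.coeff 0 ≠ 0 := by
      intro h
      rw [hPR, mul_coeff_zero, h, zero_mul] at h0
      exact h0 rfl
    have hR0 : R ≠ 0 := by
      rintro rfl
      simp [hPR] at hP0
    have hdegR : k + R.natDegree = 2 * n := by
      rw [← hdegP, hPR, natDegree_mul hQm.ne_zero hR0]
    have hdvd : reflect k Q ∣ P := by
      refine ⟨reflect R.natDegree R, ?_⟩
      rw [← reflect_mul Q R le_rfl le_rfl, ← hPR, ← hk, hdegR, hrefl]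
    have hdegQ' : (reflect k Q).natDegree = k := by
      refine le_antisymm (natDegree_reflect_le_of_le le_rfl) (le_natDegree_of_ne_zero ?_)
      rw [coeff_reflect, revAt_le le_rfl]
      simpa using hQ0
    have hcop : IsCoprime Q (reflect k Q) := by
      rw [isCoprime_iff_aeval_ne_zero_of_isAlgClosed ℝ ℂ]
      intro w
      by_contra! hw
      obtain ⟨hw1, hw2⟩ := hw
      have hw0 : w ≠ 0 := by
        rintro rfl
        rw [aeval_def, eval₂_at_zero, coeff_reflect, revAt_zero] at hw2
        simp [hk, hQm.coeff_natDegree] at hw2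
      let _ : Invertible w⁻¹ := invertibleOfNonzero (inv_ne_zero hw0)
      have h1 := eval₂_reflect_eq_zero_iff (algebraMap ℝ ℂ) w⁻¹ k Q le_rfl
      rw [invOf_eq_inv, inv_inv, ← aeval_def, ← aeval_def] at h1
      have h2 := hQr _ (h1.1 hw2)
      rw [← hQr _ hw1, norm_inv] at h2
      have h3 : 0 < ‖w‖ := norm_pos_iff.2 hw0
      have h4 : ‖w‖ * ‖w‖ = 1 := by
        rw [← mul_inv_cancel₀ h3.ne', h2]
      have h5 : ‖w‖ = 1 := by nlinarith
      exact hr1 ((hQr _ hw1) ▸ h5)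
    obtain ⟨S, hS⟩ := hcop.mul_dvd (Dvd.intro _ hPR.symm) hdvd
    have hT0 : Q * reflect k Q ≠ 0 := fun h => hP0 (by rw [hS, h, zero_mul])
    have hS0 : S ≠ 0 := right_ne_zero_of_mul (hS ▸ hP0)
    have hdegT : (Q * reflect k Q).natDegree = k + k := by
      rw [natDegree_mul hQm.ne_zero (right_ne_zero_of_mul hT0), hdegQ']
    have hdegS : k + k + S.natDegree = 2 * n := by
      rw [← hdegP, hS, natDegree_mul hT0 hS0, hdegT]
    have hTr : reflect (k + k) (Q * reflect k Q) = Q * reflect k Q := by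
      rw [reflect_mul _ _ le_rfl hdegQ'.le, reflect_reflect, mul_comm]
    obtain ⟨D, hD, hDS⟩ := ih (n - k) (by omega) S (by omega) (by
        rw [hS, show 2 * n = (k + k) + 2 * (n - k) by omega,
          reflect_mul _ _ hdegT.le (by omega), hTr] at hrefl
        exact mul_left_cancel₀ hT0 hrefl) (by
        intro z hz
        have h1 := hpos z hz
        have h2 : conj z ^ n = conj z ^ k * conj z ^ (n - k) := by
          rw [← pow_add]
          congr 1
          omega
        rw [hS, map_mul, h2, show conj z ^ k * conj z ^ (n - k) * (aeval z (Q * reflect k Q) *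
          aeval z S) = (conj z ^ k * aeval z (Q * reflect k Q)) * (conj z ^ (n - k) * aeval z S) by
            ring, conj_pow_mul_aeval_mul_reflect le_rfl hz, Complex.re_ofReal_mul] at h1
        exact pos_of_mul_pos_right h1 (Complex.normSq_nonneg _))
    refine ⟨Q * D, natDegree_mul_le.trans (by omega), ?_⟩
    rw [show n = k + (n - k) by omega, reflect_mul _ _ le_rfl hD, hS, ← hDS]
    ring

open Polynomial ComplexConjugate in
/-- The sum of two autocorrelations of real polynomials of degree at most `n` is the autocorrelation
of a real polynomial of degree at most `n`. -/
theorem exists_mul_reflect_eq_add {A B : ℝ[X]} {n : ℕ} (hA : A.natDegree ≤ n)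
    (hB : B.natDegree ≤ n) :
    ∃ D : ℝ[X], D.natDegree ≤ n ∧
      D * reflect n D = A * reflect n A + B * reflect n B := by
  by_cases hAB : A = 0 ∧ B = 0
  · obtain ⟨rfl, rfl⟩ := hAB
    exact ⟨0, by simp⟩
  -- Without the gcd there are no common zeros, so the sum becomes strictly positive on the circle;
  -- the gcd is multiplied back into `D` at the end.
  obtain ⟨G, A', B', hG, hA', hB', hcop⟩ : ∃ G A' B' : ℝ[X], G ≠ 0 ∧ A = G * A' ∧ B = G * B' ∧
      IsCoprime A' B' := by
    have hg : EuclideanDomain.gcd A B ≠ 0 := fun h => hAB (EuclideanDomain.gcd_eq_zero_iff.1 h)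
    obtain ⟨A', hA'⟩ := EuclideanDomain.gcd_dvd_left A B
    obtain ⟨B', hB'⟩ := EuclideanDomain.gcd_dvd_right A B
    refine ⟨_, A', B', hg, hA', hB', ?_⟩
    refine ⟨EuclideanDomain.gcdA A B, EuclideanDomain.gcdB A B, mul_left_cancel₀ hg ?_⟩
    have := EuclideanDomain.gcd_eq_gcd_ab A B
    linear_combination -this - EuclideanDomain.gcdA A B * hA' - EuclideanDomain.gcdB A B * hB'
  have hGn : G.natDegree ≤ n := by
    by_cases h : A = 0
    · have h' : B ≠ 0 := fun h' => hAB ⟨h, h'⟩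
      exact (natDegree_le_of_dvd ⟨B', hB'⟩ h').trans hB
    · exact (natDegree_le_of_dvd ⟨A', hA'⟩ h).trans hA
  obtain ⟨m, rfl⟩ : ∃ m, n = G.natDegree + m := ⟨_, (Nat.add_sub_cancel' hGn).symm⟩
  have key : ∀ F F' : ℝ[X], F.natDegree ≤ G.natDegree + m → F = G * F' → F'.natDegree ≤ m := by
    rintro F F' hF rfl
    by_cases h : F' = 0
    · simp [h]
    · rw [natDegree_mul hG h] at hF
      omega
  have hA'm := key _ _ hA hA'
  have hB'm := key _ _ hB hB'
  have hdeg : ∀ F : ℝ[X], F.natDegree ≤ m → (F * reflect m F).natDegree ≤ 2 * m := fun F hF =>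
    natDegree_mul_le.trans (by have := natDegree_reflect_le_of_le hF; omega)
  have hrefl : ∀ F : ℝ[X], F.natDegree ≤ m →
      reflect (2 * m) (F * reflect m F) = F * reflect m F := fun F hF => by
    rw [two_mul, reflect_mul _ _ hF (natDegree_reflect_le_of_le hF), reflect_reflect, mul_comm]
  obtain ⟨D, hD, hDe⟩ := exists_mul_reflect_eq_of_pos m (A' * reflect m A' + B' * reflect m B')
    (natDegree_add_le_of_degree_le (hdeg _ hA'm) (hdeg _ hB'm))
    (by rw [reflect_add, hrefl _ hA'm, hrefl _ hB'm]) (by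
      intro z hz
      rw [map_add, mul_add, conj_pow_mul_aeval_mul_reflect hA'm hz,
        conj_pow_mul_aeval_mul_reflect hB'm hz, ← Complex.ofReal_add, Complex.ofReal_re]
      rcases (isCoprime_iff_aeval_ne_zero_of_isAlgClosed ℝ ℂ _ _).1 hcop z with h | h
      · exact add_pos_of_pos_of_nonneg (Complex.normSq_pos.2 h) (Complex.normSq_nonneg _)
      · exact add_pos_of_nonneg_of_pos (Complex.normSq_nonneg _) (Complex.normSq_pos.2 h))
  refine ⟨G * D, natDegree_mul_le.trans (by omega), ?_⟩
  rw [hA', hB', reflect_mul _ _ le_rfl hD, reflect_mul _ _ le_rfl hA'm, reflect_mul _ _ le_rfl hB'm]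
  linear_combination G * reflect G.natDegree G * hDe

/-! ### Squared coefficient norms as variances. -/

open Polynomial in
/-- The sum of the squares of the coefficients. -/
noncomputable def coeffSqSum (P : ℝ[X]) : ℝ := ∑ i ∈ P.support, P.coeff i ^ 2

open Polynomial in
theorem coeffSqSum_eq_sum_range {P : ℝ[X]} {n : ℕ} (h : P.natDegree ≤ n) :
    coeffSqSum P = ∑ i ∈ Finset.range (n + 1), P.coeff i ^ 2 := by
  refine Finset.sum_subset (fun i hi => ?_) fun i _ hi => ?_
  · have := le_natDegree_of_mem_supp i hi
    simp only [Finset.mem_range]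
    omega
  · simp [notMem_support_iff.1 hi]

open Polynomial in
theorem coeff_mul_reflect_self {P : ℝ[X]} {n : ℕ} (h : P.natDegree ≤ n) :
    (P * reflect n P).coeff n = coeffSqSum P := by
  rw [coeffSqSum_eq_sum_range h, coeff_mul, Finset.Nat.sum_antidiagonal_eq_sum_range_succ_mk]
  refine Finset.sum_congr rfl fun i hi => ?_
  have : i ≤ n := by simp at hi; omega
  rw [coeff_reflect, revAt_le (Nat.sub_le _ _), Nat.sub_sub_self this]
  ring

open Polynomial in
theorem coeffSqSum_nonneg (P : ℝ[X]) : 0 ≤ coeffSqSum P :=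
  Finset.sum_nonneg fun _ _ => sq_nonneg _

open Polynomial in
theorem coeffSqSum_pos {P : ℝ[X]} (h : P ≠ 0) : 0 < coeffSqSum P :=
  Finset.sum_pos (fun i hi => by have := mem_support_iff.1 hi; positivity)
    (nonempty_support_iff.2 h)

open Polynomial in
theorem coeffSqSum_C_mul (s : ℝ) (P : ℝ[X]) : coeffSqSum (C s * P) = s ^ 2 * coeffSqSum P := by
  rw [coeffSqSum_eq_sum_range (natDegree_C_mul_le s P), coeffSqSum_eq_sum_range le_rfl,
    Finset.mul_sum]
  exact Finset.sum_congr rfl fun i _ => by rw [coeff_C_mul]; ring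

open Polynomial in
theorem coeffSqSum_X_mul (P : ℝ[X]) : coeffSqSum (X * P) = coeffSqSum P := by
  by_cases hP : P = 0
  · simp [hP]
  rw [coeffSqSum_eq_sum_range (natDegree_X_mul hP).le, coeffSqSum_eq_sum_range le_rfl,
    Finset.sum_range_succ']
  simp

open Polynomial in
theorem coeffSqSum_X_pow_mul (m : ℕ) (P : ℝ[X]) : coeffSqSum (X ^ m * P) = coeffSqSum P := by
  induction m with
  | zero => simp
  | succ m ih => rw [pow_succ', mul_assoc, coeffSqSum_X_mul, ih]

open Polynomial in
/-- The Pythagorean identity behind the splitting of a two-channel moving average into its output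
and an orthogonal complement. -/
theorem coeffSqSum_add_coeffSqSum {A B D : ℝ[X]} {n : ℕ} (hA : A.natDegree ≤ n)
    (hB : B.natDegree ≤ n) (hD : D.natDegree ≤ n)
    (h : D * reflect n D = A * reflect n A + B * reflect n B) (F c : ℝ[X]) :
    coeffSqSum (F * A + c * reflect n B) + coeffSqSum (F * B - c * reflect n A)
      = coeffSqSum (F * D) + coeffSqSum (c * D) := by
  set k := max F.natDegree c.natDegree with hk
  have hF : F.natDegree ≤ k := le_max_left _ _
  have hc : c.natDegree ≤ k := le_max_right _ _
  have hA' := natDegree_reflect_le_of_le hA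
  have hB' := natDegree_reflect_le_of_le hB
  have hd : ∀ {P Q : ℝ[X]}, P.natDegree ≤ k → Q.natDegree ≤ n → (P * Q).natDegree ≤ k + n :=
    fun h1 h2 => natDegree_mul_le.trans (by omega)
  rw [← coeff_mul_reflect_self (natDegree_add_le_of_degree_le (hd hF hA) (hd hc hB')),
    ← coeff_mul_reflect_self ((natDegree_sub_le _ _).trans (max_le (hd hF hB) (hd hc hA'))),
    ← coeff_mul_reflect_self (hd hF hD), ← coeff_mul_reflect_self (hd hc hD), ← coeff_add,
    ← coeff_add]
  congr 1
  simp only [reflect_add, reflect_sub, reflect_mul _ _ hF hA, reflect_mul _ _ hF hB,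
    reflect_mul _ _ hF hD, reflect_mul _ _ hc hA', reflect_mul _ _ hc hB', reflect_mul _ _ hc hD,
    reflect_reflect]
  -- The cross terms in `F` and `c` cancel between the two channels, leaving `(F F* + c c*)(A A* + B
  -- B*)`.
  linear_combination (-(F * reflect k F) - c * reflect k c) * h

/-! ### The forward shift action. -/

open Polynomial in
/-- A polynomial acts on sequences by substitution of the forward shift for the variable. -/
noncomputable def shiftAct (P : ℝ[X]) : (ℕ → ℝ) →ₗ[ℝ] (ℕ → ℝ) :=
  aeval (LinearMap.funLeft ℝ ℝ Nat.succ) P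

open Polynomial in
theorem shiftAct_mul (P Q : ℝ[X]) (u : ℕ → ℝ) :
    shiftAct (P * Q) u = shiftAct P (shiftAct Q u) := by
  simp [shiftAct]

open Polynomial in
theorem shiftAct_add (P Q : ℝ[X]) (u : ℕ → ℝ) :
    shiftAct (P + Q) u = shiftAct P u + shiftAct Q u := by
  simp [shiftAct]

open Polynomial in
theorem shiftAct_monomial (c : ℝ) (n : ℕ) (u : ℕ → ℝ) (k : ℕ) :
    shiftAct (monomial n c) u k = c * u (k + n) := by
  have h : ∀ (n : ℕ) (u : ℕ → ℝ) (k : ℕ),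
      (LinearMap.funLeft ℝ ℝ Nat.succ ^ n) u k = u (k + n) := by
    intro n
    induction n with
    | zero => simp
    | succ n ih =>
      intro u k
      rw [pow_succ, Module.End.mul_apply, ih, LinearMap.funLeft_apply]
      rfl
  rw [shiftAct, aeval_monomial, ← Algebra.smul_def, LinearMap.smul_apply, Pi.smul_apply, h,
    smul_eq_mul]

open Polynomial in
theorem shiftAct_sum {ι : Type*} (s : Finset ι) (P : ι → ℝ[X]) (u : ℕ → ℝ) (k : ℕ) :
    shiftAct (∑ i ∈ s, P i) u k = ∑ i ∈ s, shiftAct (P i) u k := by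
  simp [shiftAct]

open Polynomial in
theorem shiftAct_apply {P : ℝ[X]} {n : ℕ} (h : P.natDegree ≤ n) (u : ℕ → ℝ) (k : ℕ) :
    shiftAct P u k = ∑ j ∈ Finset.range (n + 1), P.coeff j * u (k + j) := by
  conv_lhs => rw [P.as_sum_range' (n + 1) (by omega), shiftAct_sum]
  simp only [shiftAct_monomial]

open Polynomial in
theorem shiftAct_C_add_X_mul (s : ℝ) (P : ℝ[X]) (u : ℕ → ℝ) (k : ℕ) :
    shiftAct (C s + X * P) u k = s * u k + shiftAct P (fun n => u (n + 1)) k := by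
  rw [shiftAct_add, Pi.add_apply, ← monomial_zero_left, shiftAct_monomial, add_zero, mul_comm X,
    shiftAct_mul]
  have h : shiftAct X u = fun n => u (n + 1) := by
    funext n
    rw [← monomial_one_one_eq_X, shiftAct_monomial, one_mul]
  rw [h]

open Polynomial in
theorem shiftAct_C_mul (s : ℝ) (P : ℝ[X]) (u : ℕ → ℝ) (k : ℕ) :
    shiftAct (C s * P) u k = s * shiftAct P u k := by
  rw [shiftAct_mul, ← monomial_zero_left, shiftAct_monomial, add_zero]

open Polynomial in
@[fun_prop]
theorem measurable_shiftAct (P : ℝ[X]) : Measurable (fun u : ℕ → ℝ => shiftAct P u) := by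
  refine measurable_pi_iff.2 fun k => ?_
  simp only [shiftAct_apply (P := P) le_rfl]
  fun_prop

/-! ### Gaussian linear combinations and the Cramér–Wold device. -/

theorem hasLaw_sum_const_mul {ι Ω : Type*} [MeasurableSpace Ω] {μ : Measure Ω}
    [IsProbabilityMeasure μ] {e : ι → Ω → ℝ} (he : ∀ i, HasLaw (e i) (gaussianReal 0 1) μ)
    (hi : iIndepFun e μ) (c : ι → ℝ) (s : Finset ι) :
    HasLaw (fun ω => ∑ i ∈ s, c i * e i ω)
      (gaussianReal 0 (∑ i ∈ s, c i ^ 2).toNNReal) μ := by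
  classical
  have hi' : iIndepFun (fun i ω => c i * e i ω) μ :=
    hi.comp (fun i x => c i * x) (fun i => measurable_const_mul _)
  have hm : ∀ i, AEMeasurable (fun ω => c i * e i ω) μ := fun i => (he i).aemeasurable.const_mul _
  refine ⟨Finset.aemeasurable_fun_sum _ fun i _ => hm i, ?_⟩
  induction s using Finset.induction_on with
  | empty => simp
  | insert a s ha ih =>
    have h1 : IndepFun (fun ω => c a * e a ω) (fun ω => ∑ i ∈ s, c i * e i ω) μ := by
      have := (hi'.indepFun_finsetSum_of_notMem₀ hm ha).symm
      convert this using 1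
      funext ω
      simp
    have h2 := gaussianReal_add_gaussianReal_of_indepFun h1
      (gaussianReal_const_mul (he a) (c a)).map_eq ih
    have h3 : (fun ω => ∑ i ∈ insert a s, c i * e i ω)
        = (fun ω => c a * e a ω) + fun ω => ∑ i ∈ s, c i * e i ω := by
      funext ω
      simp [Finset.sum_insert ha]
    rw [h3, h2, Finset.sum_insert ha,
      Real.toNNReal_add (sq_nonneg _) (Finset.sum_nonneg fun i _ => sq_nonneg _)]
    congr 1
    · simp
    · congr 1
      ext
      simp [sq_nonneg]

open Polynomial in
theorem hasLaw_shiftAct {Ω : Type*} [MeasurableSpace Ω] {μ : Measure Ω} [IsProbabilityMeasure μ]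
    {e : ℕ → Ω → ℝ} (he : ∀ i, HasLaw (e i) (gaussianReal 0 1) μ) (hi : iIndepFun e μ)
    (P : ℝ[X]) :
    HasLaw (fun ω => shiftAct P (fun n => e n ω) 0)
      (gaussianReal 0 (coeffSqSum P).toNNReal) μ := by
  have := hasLaw_sum_const_mul he hi P.coeff (Finset.range (P.natDegree + 1))
  rw [← coeffSqSum_eq_sum_range le_rfl] at this
  simpa only [shiftAct_apply le_rfl, zero_add] using this

open Polynomial in
/-- The law of a random sequence is determined by the laws of its finite linear combinations. -/
theorem map_eq_of_map_shiftAct_eq {Ω Ω' : Type*} [MeasurableSpace Ω] [MeasurableSpace Ω']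
    {μ : Measure Ω} {μ' : Measure Ω'} [IsProbabilityMeasure μ] [IsProbabilityMeasure μ']
    {X : Ω → ℕ → ℝ} {X' : Ω' → ℕ → ℝ} (hX : Measurable X) (hX' : Measurable X')
    (h : ∀ F : ℝ[X], μ.map (fun ω => shiftAct F (X ω) 0) = μ'.map fun ω => shiftAct F (X' ω) 0) :
    μ.map X = μ'.map X' := by
  have : IsProbabilityMeasure (μ.map X) := Measure.isProbabilityMeasure_map hX.aemeasurable
  have : IsProbabilityMeasure (μ'.map X') := Measure.isProbabilityMeasure_map hX'.aemeasurable
  refine IsProjectiveLimit.unique (P := fun I => (μ.map X).map I.restrict) (fun I => rfl)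
    fun I => ?_
  have hr : Measurable (I.restrict : (ℕ → ℝ) → (I → ℝ)) := Finset.measurable_restrict I
  have := Measure.isProbabilityMeasure_map (μ := μ.map X) hr.aemeasurable
  have := Measure.isProbabilityMeasure_map (μ := μ'.map X') hr.aemeasurable
  refine Measure.ext_of_charFunDual (funext fun l => ?_)
  rw [charFunDual_eq_charFun_map_one, charFunDual_eq_charFun_map_one,
    Measure.map_map l.continuous.measurable hr, Measure.map_map l.continuous.measurable hr,
    Measure.map_map (l.continuous.measurable.comp hr) hX',
    Measure.map_map (l.continuous.measurable.comp hr) hX]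
  -- A functional on finitely many coordinates is a polynomial in the shift, evaluated at time `0`.
  have hF : ∀ u : ℕ → ℝ, l (I.restrict u)
      = shiftAct (∑ i : I, monomial i (l (Pi.single i 1))) u 0 := by
    intro u
    rw [shiftAct_sum]
    simp only [shiftAct_monomial, zero_add]
    conv_lhs => rw [← Finset.univ_sum_single (I.restrict u), map_sum]
    refine Finset.sum_congr rfl fun i _ => ?_
    rw [show (Pi.single i (I.restrict u i) : I → ℝ) = u i • Pi.single i 1 by
      rw [← Pi.single_smul]; simp, map_smul, smul_eq_mul, mul_comm]
  have h1 := h (∑ i : I, monomial i (l (Pi.single i 1)))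
  simp only [← hF] at h1
  exact congrArg (fun ν => charFun ν 1) h1.symm

/-! ### Constructing white noise on the given space. -/

-- Probability integral transform: the Gaussian cdf is continuous and strictly increasing, so it
-- pushes the law to the uniform one.
open Set Filter Topology in
theorem exists_measurable_map_gaussianReal_eq_volume :
    ∃ φ : ℝ → unitInterval, Measurable φ ∧ (gaussianReal 0 1).map φ = volume := by
  set γ := gaussianReal 0 1 with hγ
  have hγ0 : NullSingletonClass γ :=
    nullSingletonClass_gaussianReal one_ne_zero
  have hcont : Continuous (cdf γ) := by
    refine continuous_iff_continuousAt.2 fun x => ?_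
    rw [(monotone_cdf γ).continuousAt_iff_leftLim_eq_rightLim, StieltjesFunction.rightLim_eq]
    have h1 : γ {x} = 0 := measure_singleton x
    rw [← measure_cdf γ, StieltjesFunction.measure_singleton, ENNReal.ofReal_eq_zero] at h1
    exact le_antisymm ((monotone_cdf γ).leftLim_le le_rfl) (by linarith)
  have hmono : StrictMono (cdf γ) := by
    intro x y hxy
    have h1 : 0 < γ (Ioc x y) := by
      rw [pos_iff_ne_zero]
      intro h
      have := gaussianReal_absolutelyContinuous' 0 one_ne_zero h
      simp at this
      linarith
    rw [← measure_cdf γ, StieltjesFunction.measure_Ioc, ENNReal.ofReal_pos] at h1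
    linarith
  refine ⟨fun x => ⟨cdf γ x, cdf_nonneg γ x, cdf_le_one γ x⟩,
    hcont.measurable.subtype_mk, ?_⟩
  have hm : Measurable fun x => (⟨cdf γ x, cdf_nonneg γ x, cdf_le_one γ x⟩ : unitInterval) :=
    hcont.measurable.subtype_mk
  have := Measure.isProbabilityMeasure_map (μ := γ) hm.aemeasurable
  refine Measure.ext_of_Iic _ _ fun t => ?_
  rw [Measure.map_apply hm measurableSet_Iic, unitInterval.volume_Iic]
  have hs : (fun x => (⟨cdf γ x, cdf_nonneg γ x, cdf_le_one γ x⟩ : unitInterval)) ⁻¹' Iic t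
      = {x | cdf γ x ≤ t} := rfl
  rw [hs]
  rcases eq_or_lt_of_le t.2.1 with h0 | h0
  · have : {x | cdf γ x ≤ t} = ∅ := by
      ext x
      simp only [mem_ofPred_eq, mem_empty_iff_false, iff_false, not_le, ← h0]
      exact (cdf_nonneg γ (x - 1)).trans_lt (hmono (by linarith))
    rw [this, ← h0]
    simp
  rcases eq_or_lt_of_le t.2.2 with h1 | h1
  · have : {x | cdf γ x ≤ t} = univ := by
      ext x
      simp [h1, cdf_le_one γ x]
    rw [this, h1]
    simp
  obtain ⟨x, hx⟩ : ∃ x, cdf γ x = t := by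
    obtain ⟨a, ha⟩ := ((tendsto_cdf_atBot γ).eventually_lt_const h0).exists
    obtain ⟨b, hb⟩ := ((tendsto_cdf_atTop γ).eventually_const_lt h1).exists
    exact mem_range_of_exists_le_of_exists_ge hcont ⟨a, ha.le⟩ ⟨b, hb.le⟩
  have : {y | cdf γ y ≤ t} = Iic x := by
    ext y
    simp [← hx, hmono.le_iff_le]
  rw [this, ← hx, ofReal_cdf]

/-- **Transfer**: a random variable with the same law as the first component of a pair can be
completed to a pair with the same joint law, if there is an independent Gaussian variable. -/
theorem exists_map_prodMk_eq {Ω Ω' E T : Type*} [MeasurableSpace Ω] [MeasurableSpace Ω']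
    [MeasurableSpace E] [MeasurableSpace T] [StandardBorelSpace T] [Nonempty T]
    {μ : Measure Ω} {μ' : Measure Ω'} [IsProbabilityMeasure μ] [IsProbabilityMeasure μ']
    {Y : Ω → E} {Y' : Ω' → E} {W : Ω' → T} {g : Ω → ℝ} (hY : Measurable Y)
    (hW : Measurable W) (hg : Measurable g) (hgl : μ.map g = gaussianReal 0 1)
    (hYg : IndepFun Y g μ) (h : μ.map Y = μ'.map Y') :
    ∃ Z : Ω → T, Measurable Z ∧ μ.map (fun ω => (Y ω, Z ω)) = μ'.map fun ω => (Y' ω, W ω) := by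
  obtain ⟨φ, hφ, hφl⟩ := exists_measurable_map_gaussianReal_eq_volume
  -- The conditional law of `W` given `Y'` is sampled by `f` from a uniform variable, here `φ (g
  -- ω)`.
  obtain ⟨f, hf, hfl⟩ := (condDistrib W Y' μ').exists_measurable_map_eq_unitInterval
  have hf' : Measurable fun p : E × unitInterval => (p.1, f p.1 p.2) :=
    measurable_fst.prodMk hf
  refine ⟨fun ω => f (Y ω) (φ (g ω)), hf.comp (hY.prodMk (hφ.comp hg)), ?_⟩
  have h1 : μ.map (fun ω => (Y ω, φ (g ω))) = (μ.map Y).prod volume := by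
    have := (hYg.comp measurable_id hφ).map_prod_eq_prod_map_map hY.aemeasurable
      (hφ.comp hg).aemeasurable
    rw [← hφl, ← hgl, Measure.map_map hφ hg]
    exact this
  have := Measure.isProbabilityMeasure_map (μ := μ) hY.aemeasurable
  have h2 : μ.map (fun ω => (Y ω, f (Y ω) (φ (g ω))))
      = ((μ.map Y).prod volume).map fun p : E × unitInterval => (p.1, f p.1 p.2) := by
    rw [← h1]
    exact (Measure.map_map hf' (hY.prodMk (hφ.comp hg))).symm
  rw [h2, ← compProd_map_condDistrib hW.aemeasurable, ← h]
  ext s hs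
  rw [Measure.map_apply hf' hs, Measure.prod_apply (hf' hs), Measure.compProd_apply hs]
  refine lintegral_congr fun a => ?_
  rw [← hfl]
  exact (Measure.map_apply (hf.comp measurable_prodMk_left) (measurable_prodMk_left hs)).symm

open Polynomial in
/-- A combination of two independent random sequences, each of which is a one-sided moving average
of its own white noise, is a moving average of a white noise on the same probability space, with
any coefficients that match the spectrum. -/
theorem exists_whiteNoise_of_shiftAct_add {Ω : Type*} [MeasurableSpace Ω] {μ : Measure Ω}
    [IsProbabilityMeasure μ] {e₁ e₂ : ℕ → Ω → ℝ}
    (he₁ : ∀ i, HasLaw (e₁ i) (gaussianReal 0 1) μ) (hi₁ : iIndepFun e₁ μ)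
    (he₂ : ∀ i, HasLaw (e₂ i) (gaussianReal 0 1) μ) (hi₂ : iIndepFun e₂ μ)
    {u v : Ω → ℕ → ℝ} (hu : Measurable u) (hv : Measurable v) (huv : IndepFun u v μ)
    {a₁ a₂ : ℝ[X]} (hua : ∀ᵐ ω ∂μ, u ω = shiftAct a₁ fun n => e₁ n ω)
    (hva : ∀ᵐ ω ∂μ, v ω = shiftAct a₂ fun n => e₂ n ω)
    {P Q R S D : ℝ[X]}
    (hD : ∀ s : ℝ, ∀ F : ℝ[X], coeffSqSum ((C s * R + F * P) * a₁)
      + coeffSqSum ((C s * S + F * Q) * a₂) = s ^ 2 + coeffSqSum (F * D)) :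
    ∃ e : ℤ → Ω → ℝ, (∀ i, HasLaw (e i) (gaussianReal 0 1) μ) ∧ iIndepFun e μ ∧
      ∀ᵐ ω ∂μ, shiftAct P (u ω) + shiftAct Q (v ω) = shiftAct D fun n : ℕ => e n ω := by
  set γ := gaussianReal 0 1 with hγ
  let ν : Measure (ℤ → ℝ) := Measure.infinitePi fun _ => γ
  let y : Ω → ℕ → ℝ := fun ω => shiftAct P (u ω) + shiftAct Q (v ω)
  let g : Ω → ℝ := fun ω => shiftAct R (u ω) 0 + shiftAct S (v ω) 0
  let y' : (ℤ → ℝ) → ℕ → ℝ := fun e => shiftAct D fun n : ℕ => e n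
  -- Prepending `g` to `y` makes every joint linear combination one shift polynomial: its constant
  -- term weights `g`, its `divX` acts on `y`. Then `hD` matches all variances with those of the
  -- product law.
  let cons : ℝ × (ℕ → ℝ) → ℕ → ℝ := fun p n => Nat.casesOn n p.1 p.2
  have hy : Measurable y := by fun_prop
  have hg : Measurable g := by fun_prop
  have hy' : Measurable y' := (measurable_shiftAct D).comp (by fun_prop)
  have hcons : Measurable cons := by
    refine measurable_pi_iff.2 fun n => ?_
    cases n with
    | zero => exact measurable_fst
    | succ n => exact (measurable_pi_apply n).comp measurable_snd
  have hcons_act : ∀ (F : ℝ[X]) (x : ℝ) (t : ℕ → ℝ), shiftAct F (cons (x, t)) 0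
      = F.coeff 0 * x + shiftAct F.divX t 0 := by
    intro F x t
    conv_lhs => rw [← F.X_mul_divX_add, add_comm, shiftAct_C_add_X_mul]
    rfl
  have hX : Measurable fun ω => cons (g ω, y ω) := hcons.comp (hg.prodMk hy)
  have hX' : Measurable fun p : ℝ × (ℤ → ℝ) => cons (p.1, y' p.2) :=
    hcons.comp (measurable_fst.prodMk (hy'.comp measurable_snd))
  have hν : ∀ i : ℤ, ν.map (fun e => e i) = γ := fun i => Measure.infinitePi_map_eval _ i
  have hνi : iIndepFun (fun (i : ℤ) (e : ℤ → ℝ) => e i) ν :=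
    iIndepFun_infinitePi (P := fun _ : ℤ => γ) (X := fun _ x => x) fun _ => measurable_id
  have hlaw : μ.map (fun ω => cons (g ω, y ω))
      = (γ.prod ν).map fun p => cons (p.1, y' p.2) := by
    refine map_eq_of_map_shiftAct_eq hX hX' fun F => ?_
    set s := F.coeff 0
    set G := F.divX
    have h1 : (fun ω => shiftAct F (cons (g ω, y ω)) 0)
        = (fun ω => shiftAct (C s * R + G * P) (u ω) 0)
          + fun ω => shiftAct (C s * S + G * Q) (v ω) 0 := by
      funext ω
      rw [hcons_act]
      simp only [g, y, Pi.add_apply, shiftAct_add, shiftAct_C_mul, shiftAct_mul F.divX,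
        map_add, s, G]
      ring
    have h2 : HasLaw (fun ω => shiftAct (C s * R + G * P) (u ω) 0)
        (gaussianReal 0 (coeffSqSum ((C s * R + G * P) * a₁)).toNNReal) μ := by
      refine (hasLaw_shiftAct he₁ hi₁ _).congr ?_
      filter_upwards [hua] with ω hω
      rw [shiftAct_mul, ← hω]
    have h3 : HasLaw (fun ω => shiftAct (C s * S + G * Q) (v ω) 0)
        (gaussianReal 0 (coeffSqSum ((C s * S + G * Q) * a₂)).toNNReal) μ := by
      refine (hasLaw_shiftAct he₂ hi₂ _).congr ?_
      filter_upwards [hva] with ω hω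
      rw [shiftAct_mul, ← hω]
    have h4 := gaussianReal_add_gaussianReal_of_indepFun
      (huv.comp (φ := fun u => shiftAct (C s * R + G * P) u 0)
        (ψ := fun v => shiftAct (C s * S + G * Q) v 0) (by fun_prop) (by fun_prop))
      h2.map_eq h3.map_eq
    have h5 : (fun p : ℝ × (ℤ → ℝ) => shiftAct F (cons (p.1, y' p.2)) 0)
        = (fun p : ℝ × (ℤ → ℝ) => s * p.1)
          + fun p : ℝ × (ℤ → ℝ) => shiftAct (G * D) (fun n : ℕ => p.2 n) 0 := by
      funext p
      rw [hcons_act, Pi.add_apply, shiftAct_mul]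
    have h6 : HasLaw (fun p : ℝ × (ℤ → ℝ) => s * p.1)
        (gaussianReal (s * 0) (⟨s ^ 2, sq_nonneg s⟩ * 1)) (γ.prod ν) :=
      gaussianReal_const_mul ⟨measurable_fst.aemeasurable, by simp [γ]⟩ s
    have h7 : HasLaw (fun e : ℤ → ℝ => shiftAct (G * D) (fun n : ℕ => e n) 0)
        (gaussianReal 0 (coeffSqSum (G * D)).toNNReal) ν :=
      hasLaw_shiftAct (e := fun (n : ℕ) (e : ℤ → ℝ) => e n)
        (fun i => ⟨(measurable_pi_apply _).aemeasurable, hν i⟩)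
        (hνi.precomp Nat.cast_injective) (G * D)
    have h8 : HasLaw (fun p : ℝ × (ℤ → ℝ) => shiftAct (G * D) (fun n : ℕ => p.2 n) 0)
        (gaussianReal 0 (coeffSqSum (G * D)).toNNReal) (γ.prod ν) :=
      h7.fun_comp ⟨measurable_snd.aemeasurable, by simp⟩
    have h9 : IndepFun (fun p : ℝ × (ℤ → ℝ) => s * p.1)
        (fun p : ℝ × (ℤ → ℝ) => shiftAct (G * D) (fun n : ℕ => p.2 n) 0) (γ.prod ν) :=
      indepFun_prod (X := fun x => s * x)
        (Y := fun e : ℤ → ℝ => shiftAct (G * D) (fun n : ℕ => e n) 0) (by fun_prop)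
        (((measurable_pi_apply 0).comp (measurable_shiftAct _)).comp (by fun_prop))
    rw [h1, h5, gaussianReal_add_gaussianReal_of_indepFun h9 h6.map_eq h8.map_eq]
    refine h4.trans ?_
    rw [← Real.toNNReal_add (coeffSqSum_nonneg _) (coeffSqSum_nonneg _), hD,
      Real.toNNReal_add (sq_nonneg s) (coeffSqSum_nonneg _)]
    congr 1
    · simp
    · congr 1
      refine NNReal.eq ?_
      rw [Real.coe_toNNReal _ (sq_nonneg s)]
      exact (mul_one (s ^ 2)).symm
  have hgy : μ.map (fun ω => (g ω, y ω)) = γ.prod (ν.map y') := by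
    let uncons : (ℕ → ℝ) → ℝ × (ℕ → ℝ) := fun t => (t 0, fun n => t (n + 1))
    have hun : Measurable uncons := by fun_prop
    have h1 := congrArg (Measure.map uncons) hlaw
    rw [Measure.map_map hun hX, Measure.map_map hun hX'] at h1
    refine h1.trans ?_
    have h2 := Measure.map_prod_map γ ν (measurable_id (α := ℝ)) hy'
    rw [Measure.map_id] at h2
    exact h2.symm
  have := Measure.isProbabilityMeasure_map (μ := ν) hy'.aemeasurable
  have hgl : μ.map g = γ := by
    have h1 := congrArg (Measure.map Prod.fst) hgy
    rw [Measure.map_map measurable_fst (hg.prodMk hy)] at h1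
    refine h1.trans ?_
    simp
  have hyl : μ.map y = ν.map y' := by
    have h1 := congrArg (Measure.map Prod.snd) hgy
    rw [Measure.map_map measurable_snd (hg.prodMk hy)] at h1
    refine h1.trans ?_
    simp
  have hind : IndepFun y g μ := by
    refine ((indepFun_iff_map_prod_eq_prod_map_map hg.aemeasurable hy.aemeasurable).2 ?_).symm
    rw [hgl, hyl, hgy]
  obtain ⟨Z, hZ, hYZ⟩ := exists_map_prodMk_eq (W := (id : (ℤ → ℝ) → ℤ → ℝ)) hy measurable_id
    hg hgl hind hyl
  have hZl : μ.map Z = ν := by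
    have h1 := congrArg (Measure.map Prod.snd) hYZ
    rw [Measure.map_map measurable_snd (hy.prodMk hZ),
      Measure.map_map measurable_snd (hy'.prodMk measurable_id)] at h1
    refine h1.trans ?_
    exact Measure.map_id
  have hZi : ∀ i, HasLaw (fun ω => Z ω i) γ μ := fun i => by
    refine ⟨by fun_prop, ?_⟩
    rw [← hν i, ← hZl, Measure.map_map (measurable_pi_apply i) hZ]
    rfl
  refine ⟨fun i ω => Z ω i, hZi, ?_, ?_⟩
  · exact (iIndepFun_iff_hasLaw_Pi_infinitePi hZi hZ.aemeasurable).2 ⟨hZ.aemeasurable, hZl⟩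
  -- The relation between output and noise is a measurable property of their joint law, so it
  -- transfers to `(y, Z)`.
  · have hset : MeasurableSet {p : (ℕ → ℝ) × (ℤ → ℝ) | p.1 = y' p.2} :=
      measurableSet_eq_fun measurable_fst (hy'.comp measurable_snd)
    have h1 : ∀ᵐ p ∂(ν.map fun e => (y' e, id e)), p.1 = y' p.2 :=
      (ae_map_iff (hy'.prodMk measurable_id).aemeasurable hset).2 (ae_of_all _ fun _ => rfl)
    rw [← hYZ] at h1
    exact (ae_map_iff (hy.prodMk hZ).aemeasurable hset).1 h1

/-! ### Sums of independent moving averages. -/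

open Polynomial in
/-- A combination of two independent random sequences that are one-sided moving averages is a moving
average of the expected order, with a white noise on the same probability space. -/
theorem exists_movingAverage_of_shiftAct_add {Ω : Type*} [MeasurableSpace Ω] {μ : Measure Ω}
    [IsProbabilityMeasure μ] {e₁ e₂ : ℤ → Ω → ℝ}
    (he₁ : ∀ i, HasLaw (e₁ i) (gaussianReal 0 1) μ) (hi₁ : iIndepFun e₁ μ)
    (he₂ : ∀ i, HasLaw (e₂ i) (gaussianReal 0 1) μ) (hi₂ : iIndepFun e₂ μ)
    {u v : Ω → ℕ → ℝ} (hu : Measurable u) (hv : Measurable v) (huv : IndepFun u v μ)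
    {a₁ a₂ : ℝ[X]} (hua : ∀ᵐ ω ∂μ, u ω = shiftAct a₁ fun n : ℕ => e₁ n ω)
    (hva : ∀ᵐ ω ∂μ, v ω = shiftAct a₂ fun n : ℕ => e₂ n ω)
    {P Q : ℝ[X]} {m n : ℕ} (hP : (P * a₁).natDegree ≤ n) (hQ : (Q * a₂).natDegree ≤ n) :
    ∃ (D : ℝ[X]) (e : ℤ → Ω → ℝ), D.natDegree ≤ n ∧
      (∀ i, HasLaw (e i) (gaussianReal 0 1) μ) ∧ iIndepFun e μ ∧
      ∀ᵐ ω ∂μ, shiftAct P (u ω) + shiftAct (X ^ m * Q) (v ω)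
        = shiftAct D fun n : ℕ => e n ω := by
  -- If a channel vanishes, the normalisation `σ` below could be zero; the noise of the other
  -- channel then serves directly, up to a time shift.
  by_cases hP0 : P * a₁ = 0
  · refine ⟨Q * a₂, fun i => e₂ (i + m), hQ, fun i => he₂ _,
      hi₂.precomp (add_left_injective (m : ℤ)), ?_⟩
    filter_upwards [hua, hva] with ω h1 h2
    rw [h1, h2, ← shiftAct_mul, hP0, mul_comm (X ^ m), ← shiftAct_mul,
      mul_right_comm, shiftAct_mul (Q * a₂)]
    have h3 : shiftAct (X ^ m) (fun n : ℕ => e₂ n ω) = fun n : ℕ => e₂ (n + m) ω := by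
      funext n
      rw [X_pow_eq_monomial, shiftAct_monomial, one_mul]
      push_cast
      rfl
    rw [h3]
    simp [shiftAct]
  by_cases hQ0 : Q * a₂ = 0
  · refine ⟨P * a₁, e₁, hP, he₁, hi₁, ?_⟩
    filter_upwards [hua, hva] with ω h1 h2
    rw [h1, h2, ← shiftAct_mul, ← shiftAct_mul, mul_assoc, hQ0]
    simp [shiftAct]
  obtain ⟨D, hDn, hD⟩ := exists_mul_reflect_eq_add hP hQ
  have key := coeffSqSum_add_coeffSqSum hP hQ hDn hD
  have hD0 : D ≠ 0 := by
    rintro rfl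
    have h1 := key 1 0
    have h2 := coeffSqSum_pos hP0
    have h3 := coeffSqSum_pos hQ0
    have h4 : coeffSqSum (0 : ℝ[X]) = 0 := by simp [coeffSqSum]
    simp only [one_mul, zero_mul, add_zero, sub_zero, h4] at h1
    linarith
  set σ := coeffSqSum (a₁ * a₂ * D) with hσ
  have hσ0 : 0 < σ := coeffSqSum_pos (mul_ne_zero
    (mul_ne_zero (right_ne_zero_of_mul hP0) (right_ne_zero_of_mul hQ0)) hD0)
  refine ⟨D, ?_⟩
  -- `R` and `S` come from the Pythagorean identity with `c = (s / √σ) a₁ a₂`. The factor `a₁ a₂`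
  -- makes `g` a combination of `u` and `v` rather than of `e₁` and `e₂`; `√σ` gives it unit
  -- variance.
  obtain ⟨e, he, hi, h⟩ := exists_whiteNoise_of_shiftAct_add (fun i : ℕ => he₁ i)
    (hi₁.precomp Nat.cast_injective) (fun i : ℕ => he₂ i) (hi₂.precomp Nat.cast_injective)
    hu hv huv hua hva (P := P) (Q := X ^ m * Q) (D := D)
    (R := C (√σ)⁻¹ * (reflect n (Q * a₂) * a₂))
    (S := -(C (√σ)⁻¹ * (X ^ m * reflect n (P * a₁) * a₁)))
    (by
      intro s F
      have h1 := key F (C (s * (√σ)⁻¹) * (a₁ * a₂))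
      have h2 : coeffSqSum (C (s * (√σ)⁻¹) * (a₁ * a₂) * D) = s ^ 2 := by
        rw [mul_assoc, coeffSqSum_C_mul, ← hσ, mul_pow, inv_pow, Real.sq_sqrt hσ0.le, mul_assoc,
          inv_mul_cancel₀ hσ0.ne', mul_one]
      rw [← coeffSqSum_X_pow_mul m (F * (Q * a₂) - _), h2] at h1
      rw [add_comm (s ^ 2), ← h1]
      congr 2
      · simp only [C_mul]
        ring
      · simp only [C_mul]
        ring)
  exact ⟨e, hDn, he, hi, h⟩

/-! ### ARMA processes and the relay in shift form. -/

open Polynomial in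
/-- The ARMA property in terms of the forward shift. -/
theorem isARMA_iff_shiftAct {Ω : Type*} [MeasurableSpace Ω] {p q : ℕ} {x : ℕ → Ω → ℝ}
    {μ : Measure Ω} :
    IsARMA p q x μ ↔ ∃ (B A : ℝ[X]) (e : ℤ → Ω → ℝ), B.natDegree ≤ p ∧ B.coeff p = 1 ∧
      A.natDegree ≤ q ∧ (∀ i, HasLaw (e i) (gaussianReal 0 1) μ) ∧ iIndepFun e μ ∧
      ∀ᵐ ω ∂μ, shiftAct B (fun k => x k ω) = shiftAct A fun n : ℕ => e n ω := by
  have sum_flip : ∀ (n : ℕ) (f : ℕ → ℝ), ∑ j ∈ Finset.range (n + 1), f (n - j)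
      = ∑ j ∈ Finset.range (n + 1), f j := fun n f => by
    rw [← Finset.sum_range_reflect f (n + 1)]
    refine Finset.sum_congr rfl fun j _ => ?_
    congr 1
  constructor
  · rintro ⟨β, α, ε, hβ, hε, hi, h⟩
    have hdeg : ∀ (n : ℕ) (c : ℕ → ℝ),
        (∑ i ∈ Finset.range (n + 1), monomial i (c (n - i)) : ℝ[X]).natDegree ≤ n := fun n c =>
      natDegree_sum_le_of_forall_le _ _ fun i hi => (natDegree_monomial_le _).trans (by
        simp at hi; omega)
    -- Backward lags become forward shifts by reversing coefficients, so `β 0 = 1` moves to degree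
    -- `p`; the noise is reindexed by `p - q` to line up.
    refine ⟨∑ i ∈ Finset.range (p + 1), monomial i (β (p - i)),
      ∑ i ∈ Finset.range (q + 1), monomial i (α (q - i)), fun i => ε (i + (p - q)), hdeg _ _, ?_,
      hdeg _ _, fun i => hε _, hi.precomp (add_left_injective _), ?_⟩
    · simp [finsetSum_coeff, coeff_monomial, hβ]
    · have h' : ∀ᵐ ω ∂μ, ∀ k : ℕ, ∑ j ∈ Finset.range (p + 1), β j * x (k + p - j) ω
          = ∑ j ∈ Finset.range (q + 1), α j * ε (((k + p : ℕ) : ℤ) - (j : ℤ)) ω :=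
        ae_all_iff.2 fun k => h (k + p) (by omega)
      filter_upwards [h'] with ω hω
      funext k
      rw [shiftAct_sum, shiftAct_sum]
      simp only [shiftAct_monomial]
      refine Eq.trans ?_ ((hω k).trans ?_)
      · rw [← sum_flip p]
        refine Finset.sum_congr rfl fun j hj => ?_
        have : j ≤ p := by simp at hj; omega
        rw [Nat.sub_sub_self this, Nat.add_sub_assoc this]
      · rw [← sum_flip q]
        refine Finset.sum_congr rfl fun j hj => ?_
        have : j ≤ q := by simp at hj; omega
        congr 2
        push_cast [this]
        ring
  · rintro ⟨B, A, e, hB, hB1, hA, he, hi, h⟩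
    refine ⟨fun j => B.coeff (p - j), fun j => A.coeff (q - j), fun i => e (i + (q - p)),
      by simpa using hB1, fun i => he _, hi.precomp (add_left_injective _), fun k hk => ?_⟩
    obtain ⟨l, rfl⟩ : ∃ l, k = l + p := ⟨k - p, by omega⟩
    filter_upwards [h] with ω hω
    have hl := congrFun hω l
    rw [shiftAct_apply hB, shiftAct_apply hA] at hl
    rw [← sum_flip p, ← sum_flip q] at hl
    refine Eq.trans ?_ (hl.trans ?_)
    · refine Finset.sum_congr rfl fun j hj => ?_
      have : j ≤ p := by simp at hj; omega
      rw [Nat.add_sub_assoc this]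
    · refine Finset.sum_congr rfl fun j hj => ?_
      have : j ≤ q := by simp at hj; omega
      congr 2
      push_cast [this]
      ring

/-- From time index `L` on, a row contains all `L` taps without truncation, which gives a
time-invariant recursion. -/
theorem relayMatrix_mulVec_last (L : ℕ) (h : ℕ → ℝ) (k : ℕ) (t : ℕ → ℝ) :
    (relayMatrix L h (k + L + 1)).mulVec (fun i => t i) (Fin.last (k + L))
      = t (k + L) + ∑ i ∈ Finset.range L, h (L - i) * t (k + i) := by
  have h1 : (relayMatrix L h (k + L + 1)).mulVec (fun i => t i) (Fin.last (k + L))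
      = ∑ j ∈ Finset.range (k + L + 1), (if k + L = j then 1
        else if j < k + L ∧ k + L - j ≤ L then h (k + L - j) else 0) * t j := by
    rw [Finset.sum_range]
    simp [Matrix.mulVec, dotProduct, relayMatrix, Fin.ext_iff, -Fin.val_fin_lt, Fin.lt_def]
  rw [h1, Finset.sum_range_succ, Finset.sum_range_add, Finset.sum_eq_zero, zero_add, add_comm]
  · congr 1
    · simp
    · refine Finset.sum_congr rfl fun i hi => ?_
      have hi' : i < L := by simpa using hi
      rw [if_neg (by omega), if_pos (by omega), Nat.add_sub_add_left]
  · intro i hi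
    have hi' : i < k := by simpa using hi
    rw [if_neg (by omega), if_neg (by omega), zero_mul]

open Polynomial in
/-- The reversed tap polynomial of the relay, without its leading term. -/
noncomputable def relayPoly (L : ℕ) (h : ℕ → ℝ) : ℝ[X] :=
  ∑ i ∈ Finset.range L, monomial i (h (L - i))

open Polynomial in
theorem natDegree_relayPoly_le (L : ℕ) (h : ℕ → ℝ) : (relayPoly L h).natDegree ≤ L - 1 :=
  natDegree_sum_le_of_forall_le _ _ fun i hi => (natDegree_monomial_le _).trans (by
    simp at hi; omega)

open Polynomial in
/-- The effective noise solves `H x = (H - I) w + z` as a difference equation. -/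
theorem shiftAct_effectiveNoise {Ω : Type*} (L : ℕ) (h : ℕ → ℝ) (w z : ℕ → Ω → ℝ) (ω : Ω) :
    shiftAct (X ^ L + relayPoly L h) (fun k => effectiveNoise L h w z k ω)
      = shiftAct (relayPoly L h) (fun k => w k ω) + shiftAct (X ^ L) fun k => z k ω := by
  funext k
  have h1 := congrFun (relayMatrix_mulVec_effectiveNoiseVec L h (k + L + 1)
    (fun i => w i ω) (fun i => z i ω)) (Fin.last (k + L))
  have h2 : effectiveNoiseVec L h (k + L + 1) (fun i => w i ω) (fun i => z i ω)
      = fun i : Fin (k + L + 1) => effectiveNoise L h w z i ω :=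
    funext fun i => (effectiveNoise_eq_vec L h w z _ i ω).symm
  rw [h2, relayMatrix_mulVec_last L h k fun i => effectiveNoise L h w z i ω, Pi.add_apply,
    Pi.sub_apply, relayMatrix_mulVec_last L h k fun i => w i ω] at h1
  rw [shiftAct_add, Pi.add_apply, Pi.add_apply, X_pow_eq_monomial, relayPoly]
  simp only [shiftAct_sum, shiftAct_monomial, one_mul]
  rw [h1]
  simp

theorem mainTheorem2 {Ω : Type*} [MeasurableSpace Ω] (μ : Measure Ω) [IsProbabilityMeasure μ]
    (L p₁ q₁ p₂ q₂ : ℕ) (h : ℕ → ℝ) (w z : ℕ → Ω → ℝ)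
    (hw_meas : ∀ k, Measurable (w k)) (hz_meas : ∀ k, Measurable (z k))
    (hwz : IndepFun (fun ω k => w k ω) (fun ω k => z k ω) μ)
    (hw : IsARMA p₁ q₁ w μ) (hz : IsARMA p₂ q₂ z μ) :
    ∃ p q : ℕ, p ≤ L + p₁ + p₂ ∧ q ≤ max (L + p₂ + q₁ - 1) (p₁ + q₂) ∧
      IsARMA p q (effectiveNoise L h w z) μ := by
  open Polynomial in
  obtain ⟨B₁, a₁, e₁, hB₁, hB₁1, ha₁, he₁, hi₁, h₁⟩ := isARMA_iff_shiftAct.1 hw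
  obtain ⟨B₂, a₂, e₂, hB₂, hB₂1, ha₂, he₂, hi₂, h₂⟩ := isARMA_iff_shiftAct.1 hz
  have hG := natDegree_relayPoly_le L h
  set G := relayPoly L h with hGdef
  have hGc : G.coeff L = 0 := by simp +contextual [hGdef, relayPoly, coeff_monomial]
  have hH : (X ^ L + G).natDegree ≤ L :=
    natDegree_add_le_of_degree_le (natDegree_X_pow_le L) (by omega)
  have hA : (B₂ * G * a₁).natDegree ≤ max (L + p₂ + q₁ - 1) (p₁ + q₂) := by
    -- For `L = 0` the truncated `L - 1` saves no degree, but then `G = 0`.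
    rcases Nat.eq_zero_or_pos L with rfl | hL
    · simp [hGdef, relayPoly]
    · refine natDegree_mul_le.trans ?_
      have := natDegree_mul_le (p := B₂) (q := G)
      omega
  have hC : (B₁ * a₂).natDegree ≤ max (L + p₂ + q₁ - 1) (p₁ + q₂) :=
    natDegree_mul_le.trans (by omega)
  -- The delay `X ^ L` is passed as `m`, outside `Q = B₁`, so it does not count towards the degree.
  obtain ⟨D, e, hD, he, hi, hDe⟩ := exists_movingAverage_of_shiftAct_add he₁ hi₁ he₂ hi₂
    ((measurable_shiftAct B₁).comp (measurable_pi_lambda _ hw_meas))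
    ((measurable_shiftAct B₂).comp (measurable_pi_lambda _ hz_meas))
    (hwz.comp (measurable_shiftAct B₁) (measurable_shiftAct B₂)) h₁ h₂ (m := L) hA hC
  refine ⟨_, _, le_rfl, le_rfl, isARMA_iff_shiftAct.2
    ⟨(X ^ L + G) * B₁ * B₂, D, e, ?_, ?_, hD, he, hi, ?_⟩⟩
  · have := natDegree_mul_le (p := X ^ L + G) (q := B₁)
    exact natDegree_mul_le.trans (by omega)
  -- The top coefficient is the product of three ones, since `G` does not reach degree `L`.
  · rw [coeff_mul_add_eq_of_natDegree_le (natDegree_mul_le_of_le hH hB₁) hB₂,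
      coeff_mul_add_eq_of_natDegree_le hH hB₁, hB₁1, hB₂1, coeff_add, hGc]
    simp
  · filter_upwards [hDe] with ω hω
    rw [← hω, mul_assoc, mul_comm, shiftAct_mul, shiftAct_effectiveNoise, map_add]
    simp only [Function.comp, ← shiftAct_mul]
    rw [← hGdef]
    congr 2 <;> ring_nf
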